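/- Let $K=\mathbb{R}$ or $K=\mathbb{C}$, let $n\ge 1$ be an integer, $\sigma>0$ a real number and $j_0\in\mathbb{Z}$. Let $\varphi:\mathbb{R}\to K$ be continuous and compactly supported with $\varphi(k)=\delta_{k,0}$ for all $k\in\mathbb{Z}$, and put $\varphi^{[n]}(x)=\varphi(x_1)\cdots\varphi(x_n)$ for $x\in\mathbb{R}^n$. Assume that $\varphi^{[n]}$ is the mother scaling function of a compactly supported interpolating tensor product multiresolution analysis of $C_{\mathrm u}(\mathbb{R}^n)$, the space of bounded uniformly continuous functions $\mathbb{R}^n\to K$ with the supremum norm; that is, the spaces $$V_j=\Big\{\sum_{k\in\mathbb{Z}^n}a_k\,\varphi^{[n]}(2^j\cdot{}-k)\;:\;(a_k)\in\ell^\infty(\mathbb{Z}^n)\Big\},\qquad j\in\mathbb{Z},$$ satisfy $V_j\subset V_{j+1}$ for all $j$, and $\bigcup_j V_j$ is dense in $C_{\mathrm u}(\mathbb{R}^n)$. Assume further that $\varphi^{[n]}$ belongs to the Hölder space $C^r(\mathbb{R}^n)$ for some $r>\sigma$ (all derivatives of order at most $\lfloor r\rfloor$ exist and are bounded and uniformly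 continuous, and those of order $\lfloor r\rfloor$ are Hölder continuous with exponent $r-\lfloor r\rfloor$ when $r$ is not an integer). Put $\psi_0=\varphi$, $\psi_1(t)=\varphi(2t-1)$ and, for $s\in\{0,1\}^n$, $j\in\mathbb{Z}$, $k\in\mathbb{Z}^n$, $$\psi_{s,j,k}(x)=\prod_{i=1}^n\psi_{s_i}(2^jx_i-k_i),$$ and let $$B_n(j_0)=\{(0,j_0,k):k\in\mathbb{Z}^n\}\cup\{(s,j,k): s\in\{0,1\}^n\setminus\{0\},\ j\ge j_0,\ k\in\mathbb{Z}^n\}.$$ Let $B^\sigma_{\infty,\infty}(\mathbb{R}^n)$ (the Zygmund space) be the space of bounded continuous functions $f:\mathbb{R}^n\to K$ with $$\|f\|=\sup_x|f(x)|+\sup_{h\ne0}\ \sup_x\ |h|^{-\sigma}\,|\Delta_h^{m}f(x)|<\infty,\qquad m=\lfloor\sigma\rfloor+1,$$ where $\Delta_hf(x)=f(x+h)-f(x)$. Then every $\psi_\alpha$, $\alpha\in B_n(j_0)$, belongs to $B^\sigma_{\infty,\infty}(\mathbb{R}^n)$, and for every bijection $\iota:\mathbb{N}\to B_n(j_0)$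 the sequence $(\psi_{\iota(k)})_{k=0}^\infty$ is not a Schauder basis of $B^\sigma_{\infty,\infty}(\mathbb{R}^n)$. (A sequence $(e_k)$ is a Schauder basis if every $f$ in the space has exactly one expansion $f=\sum_{k=0}^\infty a_ke_k$, $a_k\in K$, with partial sums converging in norm.) -/

import Mathlib

open Filter Topology

namespace InterpWavelet

/-! ### Interpolating tensor product multiresolution analyses -/

/-- The tensor product function `φ^[n](x) = φ(x₁) ⋯ φ(xₙ)` on `ℝⁿ`. -/
noncomputable def tensorScaling {𝕜 : Type*} [RCLike 𝕜] (n : ℕ) (φ : ℝ → 𝕜) :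
    EuclideanSpace ℝ (Fin n) → 𝕜 :=
  fun x => ∏ i, φ (x i)

/-- The univariate mother functions: `ψ₀ = φ` and `ψ₁(t) = φ(2t - 1)`. -/
noncomputable def motherFun {𝕜 : Type*} [RCLike 𝕜] (φ : ℝ → 𝕜) (s : Fin 2) : ℝ → 𝕜 :=
  fun t => if s = 0 then φ t else φ (2 * t - 1)

/-- The interpolating tensor product wavelet
`ψ_{s,j,k}(x) = ∏ᵢ ψ_{sᵢ}(2ʲ xᵢ - kᵢ)` for `s ∈ {0,1}ⁿ`, `j ∈ ℤ`, `k ∈ ℤⁿ`.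
For `s = 0` it is the scaling function `φ^[n](2ʲ x - k)`. -/
noncomputable def wavelet {𝕜 : Type*} [RCLike 𝕜] {n : ℕ} (φ : ℝ → 𝕜)
    (α : (Fin n → Fin 2) × ℤ × (Fin n → ℤ)) : EuclideanSpace ℝ (Fin n) → 𝕜 :=
  fun x => ∏ i, motherFun φ (α.1 i) ((2 : ℝ) ^ α.2.1 * x i - (α.2.2 i : ℝ))

/-- The index set `B_n(j₀)`: the triples `(0, j₀, k)`, and the triples `(s, j, k)` with `s ≠ 0` and
`j ≥ j₀`, where `k ∈ ℤⁿ`. -/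
def waveletIndex (n : ℕ) (j₀ : ℤ) : Set ((Fin n → Fin 2) × ℤ × (Fin n → ℤ)) :=
  {α | (α.1 = 0 ∧ α.2.1 = j₀) ∨ (α.1 ≠ 0 ∧ j₀ ≤ α.2.1)}

/-- The space `V_j` of all functions `∑ₖ aₖ φ^[n](2ʲ x - k)` with `a ∈ ℓ^∞(ℤⁿ)`. -/
def scalingSpace {𝕜 : Type*} [RCLike 𝕜] (n : ℕ) (φ : ℝ → 𝕜) (j : ℤ) :
    Set (EuclideanSpace ℝ (Fin n) → 𝕜) :=
  {f | ∃ a : (Fin n → ℤ) → 𝕜, (∃ C : ℝ, ∀ k, ‖a k‖ ≤ C) ∧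
    ∀ x, HasSum (fun k => a k * wavelet φ ((0 : Fin n → Fin 2), j, k) x) (f x)}

/-- `φ^[n]` is the mother scaling function of a compactly supported interpolating tensor product
MRA of `C_u(ℝⁿ)`, the space of bounded uniformly continuous functions with the sup norm.
The invariance of the spaces `V_j` under dyadic dilations and translations is built into
`scalingSpace`. -/
structure IsInterpolatingTensorMRA {𝕜 : Type*} [RCLike 𝕜] (n : ℕ) (φ : ℝ → 𝕜) : Prop where
  continuous : Continuous φ
  hasCompactSupport : HasCompactSupport φ
  interpolating : ∀ k : ℤ, φ (k : ℝ) = if k = 0 then 1 else 0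
  nested : ∀ j : ℤ, scalingSpace n φ j ⊆ scalingSpace n φ (j + 1)
  dense : ∀ f : EuclideanSpace ℝ (Fin n) → 𝕜, UniformContinuous f → (∃ C : ℝ, ∀ x, ‖f x‖ ≤ C) →
    ∀ ε : ℝ, 0 < ε → ∃ j : ℤ, ∃ g ∈ scalingSpace n φ j, ∀ x, ‖f x - g x‖ ≤ ε

/-! ### Hölder spaces -/

/-- Membership in the Hölder space `C^r(ℝⁿ)`, `r ≥ 0`: with `m = ⌊r⌋`, all derivatives of order at
most `m` exist and are bounded and uniformly continuous, and those of order `m` are Hölder continuous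
with exponent `r - m` (no further condition if `r` is an integer). -/
def MemHolder {𝕜 : Type*} [RCLike 𝕜] {n : ℕ} (r : ℝ) (f : EuclideanSpace ℝ (Fin n) → 𝕜) : Prop :=
  ContDiff ℝ (⌊r⌋₊ : ℕ) f ∧
  (∀ i ≤ ⌊r⌋₊, UniformContinuous (iteratedFDeriv ℝ i f) ∧
    ∃ C : ℝ, ∀ x, ‖iteratedFDeriv ℝ i f x‖ ≤ C) ∧
  ∃ C : ℝ, ∀ x y, ‖iteratedFDeriv ℝ ⌊r⌋₊ f x - iteratedFDeriv ℝ ⌊r⌋₊ f y‖ ≤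
    C * ‖x - y‖ ^ (r - (⌊r⌋₊ : ℝ))

/-! ### The Besov space `B^σ_{∞,∞}(ℝⁿ)` (Zygmund space) -/

/-- The difference `Δ_h^m f(x) = ∑ₗ (-1)^(m-l) (m choose l) f(x + l h)` of order
`m = ⌊σ⌋ + 1`, the least integer larger than `σ`. -/
noncomputable def diff {𝕜 : Type*} [RCLike 𝕜] {n : ℕ} (σ : ℝ) (h : EuclideanSpace ℝ (Fin n))
    (f : EuclideanSpace ℝ (Fin n) → 𝕜) : EuclideanSpace ℝ (Fin n) → 𝕜 :=
  (fwdDiff h)^[⌊σ⌋₊ + 1] f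

theorem diff_add {𝕜 : Type*} [RCLike 𝕜] {n : ℕ} (σ : ℝ) (h : EuclideanSpace ℝ (Fin n))
    (f g : EuclideanSpace ℝ (Fin n) → 𝕜) (x : EuclideanSpace ℝ (Fin n)) :
    diff σ h (f + g) x = diff σ h f x + diff σ h g x := by
  simp [diff]

theorem diff_smul {𝕜 : Type*} [RCLike 𝕜] {n : ℕ} (σ : ℝ) (h : EuclideanSpace ℝ (Fin n))
    (c : 𝕜) (f : EuclideanSpace ℝ (Fin n) → 𝕜) (x : EuclideanSpace ℝ (Fin n)) :
    diff σ h (c • f) x = c * diff σ h f x := by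
  simp [diff]

/-- Membership in `B^σ_{∞,∞}(ℝⁿ)`, `σ > 0`: `f` is continuous and bounded, and
`|Δ_h^m f(x)| ≤ C |h|^σ` for all `x` and `h`. -/
def MemZygmund {𝕜 : Type*} [RCLike 𝕜] {n : ℕ} (σ : ℝ) (f : EuclideanSpace ℝ (Fin n) → 𝕜) : Prop :=
  Continuous f ∧ (∃ C : ℝ, ∀ x, ‖f x‖ ≤ C) ∧
    ∃ C : ℝ, ∀ h x, ‖diff σ h f x‖ ≤ C * ‖h‖ ^ σ

/-- `B^σ_{∞,∞}(ℝⁿ)` as a subspace of the vector space of all functions. -/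
def zygmundSubmodule (𝕜 : Type*) [RCLike 𝕜] (n : ℕ) (σ : ℝ) :
    Submodule 𝕜 (EuclideanSpace ℝ (Fin n) → 𝕜) where
  carrier := {f | MemZygmund σ f}
  zero_mem' := by
    refine ⟨continuous_const, ⟨0, by simp⟩, 0, fun h x => ?_⟩
    have := diff_smul σ h (0 : 𝕜) (0 : EuclideanSpace ℝ (Fin n) → 𝕜) x
    simp only [smul_zero, zero_mul] at this
    simp [this]
  add_mem' := by
    rintro f g ⟨hf, ⟨A, hA⟩, B, hB⟩ ⟨hg, ⟨A', hA'⟩, B', hB'⟩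
    refine ⟨hf.add hg, ⟨A + A', fun x => (norm_add_le _ _).trans (add_le_add (hA x) (hA' x))⟩,
      B + B', fun h x => ?_⟩
    rw [diff_add, add_mul]
    exact (norm_add_le _ _).trans (add_le_add (hB h x) (hB' h x))
  smul_mem' := by
    rintro c f ⟨hf, ⟨A, hA⟩, B, hB⟩
    refine ⟨hf.const_smul c, ⟨‖c‖ * A, fun x => ?_⟩, ‖c‖ * B, fun h x => ?_⟩
    · simpa using mul_le_mul_of_nonneg_left (hA x) (norm_nonneg c)
    · rw [diff_smul, norm_mul, mul_assoc]
      exact mul_le_mul_of_nonneg_left (hB h x) (norm_nonneg c)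

/-- The space `B^σ_{∞,∞}(ℝⁿ)`; it carries the Besov norm below, not the sup norm. -/
def ZygmundSpace (𝕜 : Type*) [RCLike 𝕜] (n : ℕ) (σ : ℝ) : Type _ :=
  zygmundSubmodule 𝕜 n σ

/-- A function in `B^σ_{∞,∞}(ℝⁿ)` as an element of the space. -/
def ZygmundSpace.ofFun {𝕜 : Type*} [RCLike 𝕜] {n : ℕ} {σ : ℝ}
    (f : EuclideanSpace ℝ (Fin n) → 𝕜) (hf : MemZygmund σ f) : ZygmundSpace 𝕜 n σ :=
  ⟨f, hf⟩

noncomputable instance (𝕜 : Type*) [RCLike 𝕜] (n : ℕ) (σ : ℝ) :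
    AddCommGroup (ZygmundSpace 𝕜 n σ) :=
  inferInstanceAs (AddCommGroup (zygmundSubmodule 𝕜 n σ))

noncomputable instance (𝕜 : Type*) [RCLike 𝕜] (n : ℕ) (σ : ℝ) :
    Module 𝕜 (ZygmundSpace 𝕜 n σ) :=
  inferInstanceAs (Module 𝕜 (zygmundSubmodule 𝕜 n σ))

/-- The Besov norm `sup_x |f(x)| + sup_{x, h ≠ 0} |Δ_h^m f(x)| / |h|^σ`.
(In the second supremum the terms with `h = 0` are `0`, and do not contribute.) -/
noncomputable instance (𝕜 : Type*) [RCLike 𝕜] (n : ℕ) (σ : ℝ) : Norm (ZygmundSpace 𝕜 n σ) where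
  norm f := (⨆ x, ‖f.1 x‖) +
    ⨆ p : EuclideanSpace ℝ (Fin n) × EuclideanSpace ℝ (Fin n), ‖diff σ p.1 f.1 p.2‖ / ‖p.1‖ ^ σ

theorem ZygmundSpace.norm_def {𝕜 : Type*} [RCLike 𝕜] {n : ℕ} {σ : ℝ} (f : ZygmundSpace 𝕜 n σ) :
    ‖f‖ = (⨆ x, ‖f.1 x‖) +
      ⨆ p : EuclideanSpace ℝ (Fin n) × EuclideanSpace ℝ (Fin n),
        ‖diff σ p.1 f.1 p.2‖ / ‖p.1‖ ^ σ :=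
  rfl

theorem ZygmundSpace.bdd_sup {𝕜 : Type*} [RCLike 𝕜] {n : ℕ} {σ : ℝ} (f : ZygmundSpace 𝕜 n σ) :
    BddAbove (Set.range fun x => ‖f.1 x‖) := by
  obtain ⟨C, hC⟩ := f.2.2.1
  exact ⟨C, by rintro _ ⟨x, rfl⟩; exact hC x⟩

theorem ZygmundSpace.bdd_diff {𝕜 : Type*} [RCLike 𝕜] {n : ℕ} {σ : ℝ} (f : ZygmundSpace 𝕜 n σ) :
    BddAbove (Set.range fun p : EuclideanSpace ℝ (Fin n) × EuclideanSpace ℝ (Fin n) =>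
      ‖diff σ p.1 f.1 p.2‖ / ‖p.1‖ ^ σ) := by
  obtain ⟨C, hC⟩ := f.2.2.2
  refine ⟨max C 0, ?_⟩
  rintro _ ⟨p, rfl⟩
  refine div_le_of_le_mul₀ (by positivity) (le_max_right _ _) ((hC p.1 p.2).trans ?_)
  exact mul_le_mul_of_nonneg_right (le_max_left _ _) (by positivity)

theorem ZygmundSpace.core (𝕜 : Type*) [RCLike 𝕜] (n : ℕ) (σ : ℝ) :
    NormedSpace.Core 𝕜 (ZygmundSpace 𝕜 n σ) where
  norm_nonneg f := by
    rw [norm_def]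
    exact add_nonneg (Real.iSup_nonneg fun _ => norm_nonneg _)
      (Real.iSup_nonneg fun _ => by positivity)
  norm_smul c f := by
    rw [norm_def, norm_def, mul_add, Real.mul_iSup_of_nonneg (norm_nonneg c),
      Real.mul_iSup_of_nonneg (norm_nonneg c)]
    have h1 : ∀ x, ‖(c • f).1 x‖ = ‖c‖ * ‖f.1 x‖ := fun x => norm_mul c (f.1 x)
    have h2 : ∀ p : EuclideanSpace ℝ (Fin n) × EuclideanSpace ℝ (Fin n),
        ‖diff σ p.1 (c • f).1 p.2‖ / ‖p.1‖ ^ σ = ‖c‖ * (‖diff σ p.1 f.1 p.2‖ / ‖p.1‖ ^ σ) := by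
      intro p
      have : diff σ p.1 (c • f).1 p.2 = c * diff σ p.1 f.1 p.2 := diff_smul σ p.1 c f.1 p.2
      rw [this, norm_mul, mul_div_assoc]
    simp only [h1, h2]
  norm_triangle f g := by
    rw [norm_def, norm_def, norm_def, add_add_add_comm]
    refine add_le_add (ciSup_le fun x => ?_) (ciSup_le fun p => ?_)
    · exact (norm_add_le (f.1 x) (g.1 x)).trans
        (add_le_add (le_ciSup f.bdd_sup x) (le_ciSup g.bdd_sup x))
    · have : diff σ p.1 (f + g).1 p.2 = diff σ p.1 f.1 p.2 + diff σ p.1 g.1 p.2 :=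
        diff_add σ p.1 f.1 g.1 p.2
      rw [this]
      refine le_trans ?_ (add_le_add (le_ciSup f.bdd_diff p) (le_ciSup g.bdd_diff p))
      rw [← add_div]
      exact div_le_div_of_nonneg_right (norm_add_le _ _) (by positivity)
  norm_eq_zero_iff f := by
    constructor
    · intro h
      rw [norm_def] at h
      have h1 : 0 ≤ ⨆ x, ‖f.1 x‖ := Real.iSup_nonneg fun _ => norm_nonneg _
      have h2 : 0 ≤ ⨆ p : EuclideanSpace ℝ (Fin n) × EuclideanSpace ℝ (Fin n),
          ‖diff σ p.1 f.1 p.2‖ / ‖p.1‖ ^ σ := Real.iSup_nonneg fun _ => by positivity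
      have h3 : (⨆ x, ‖f.1 x‖) = 0 := by linarith
      refine Subtype.ext (funext fun x => ?_)
      exact norm_le_zero_iff.mp ((le_ciSup f.bdd_sup x).trans h3.le)
    · rintro rfl
      have h0 : ((0 : ZygmundSpace 𝕜 n σ)).1 = (0 : EuclideanSpace ℝ (Fin n) → 𝕜) := rfl
      have hd : ∀ p : EuclideanSpace ℝ (Fin n) × EuclideanSpace ℝ (Fin n),
          diff σ p.1 (0 : EuclideanSpace ℝ (Fin n) → 𝕜) p.2 = 0 := by
        intro p
        have := diff_smul σ p.1 (0 : 𝕜) (0 : EuclideanSpace ℝ (Fin n) → 𝕜) p.2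
        simpa using this
      rw [norm_def, h0]
      simp [hd]

noncomputable instance (𝕜 : Type*) [RCLike 𝕜] (n : ℕ) (σ : ℝ) :
    NormedAddCommGroup (ZygmundSpace 𝕜 n σ) :=
  NormedAddCommGroup.ofCore (ZygmundSpace.core 𝕜 n σ)

noncomputable instance (𝕜 : Type*) [RCLike 𝕜] (n : ℕ) (σ : ℝ) :
    NormedSpace 𝕜 (ZygmundSpace 𝕜 n σ) :=
  NormedSpace.ofCore (ZygmundSpace.core 𝕜 n σ)

/-! ### Schauder bases -/

/-- The sequence `e` is a Schauder basis of `X`: every `x ∈ X` has exactly one expansion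
`x = ∑ₖ aₖ eₖ`, where the partial sums converge in norm. The continuity of the coefficient
functionals is not demanded. -/
def IsSchauderBasis (𝕜 : Type*) [RCLike 𝕜] {X : Type*} [NormedAddCommGroup X] [NormedSpace 𝕜 X]
    (e : ℕ → X) : Prop :=
  ∀ x : X, ∃! a : ℕ → 𝕜, Tendsto (fun N => ∑ k ∈ Finset.range N, a k • e k) atTop (𝓝 x)

/-- A Schauder basis in the sense of Mathlib, which includes continuous coefficient functionals, is
a Schauder basis in the sense used here. -/
theorem isSchauderBasis_of_schauderBasis {𝕜 : Type*} [RCLike 𝕜] {X : Type*}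
    [NormedAddCommGroup X] [NormedSpace 𝕜 X] (b : SchauderBasis 𝕜 X) :
    IsSchauderBasis 𝕜 (fun k => b k) := by
  intro x
  refine ⟨fun k => b.coord k x, ?_, ?_⟩
  · have := b.expansion x
    rw [HasSum, SummationFilter.conditional_filter_eq_map_range, tendsto_map'_iff] at this
    exact this
  · intro a ha
    funext i
    have h1 := ((b.coord i).continuous.tendsto x).comp ha
    refine tendsto_nhds_unique (tendsto_const_nhds.congr' ?_) h1
    filter_upwards [eventually_gt_atTop i] with N hN
    simp [map_sum, b.ortho, Pi.single_apply, hN]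

end InterpWavelet

/-!
The space `B^σ_{∞,∞}(ℝⁿ)` is not separable when `n ≥ 1`, whereas a normed space with a Schauder
basis is the closed linear span of countably many vectors, hence separable.  So no sequence
whatsoever is a Schauder basis of this space, and in particular no enumeration of the wavelets.

Non-separability is witnessed by the functions `x ↦ cos (t x₁)`, `t > 0`.  They belong to the space
since every difference `Δ_h` multiplies such a function by a factor of size at most `t ‖h‖` and
shifts its phase (`fwdDiff_iter_cosWave`), and two of them are at sup-distance at least `1`: at a
suitable point one of them equals `1` while the other one is nonpositive
(`exists_cos_eq_one_and_cos_nonpos`).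

That the wavelets belong to the space does not need the multiresolution structure either.  Each
wavelet is the composition of `φ^[n]` with an affine map of `ℝⁿ` (dyadic dilations of the
coordinates, then a translation), and these compositions preserve the space
(`MemZygmund.comp_sub`).  A function in the Hölder space `C^r` with `r > σ` is in
`B^σ_{∞,∞}` (`MemHolder.memZygmund`), because `‖Δ_h^p f‖ ≤ ‖h‖^p sup ‖D^p f‖`
(`norm_fwdDiff_iter_le`); when `⌊r⌋ = ⌊σ⌋`, the remaining difference `Δ_h` is
estimated by the Hölder condition on the derivatives of order `⌊r⌋`.
-/

namespace InterpWavelet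

/-! ### Iterated differences and derivatives -/

section Differences

variable {E F : Type*} [NormedAddCommGroup E] [NormedSpace ℝ E] [NormedAddCommGroup F]
  [NormedSpace ℝ F]

theorem contDiff_fwdDiff {k : WithTop ℕ∞} {f : E → F} (hf : ContDiff ℝ k f) (h : E) :
    ContDiff ℝ k (fwdDiff h f) :=
  (hf.comp (contDiff_id.add contDiff_const)).sub hf

theorem contDiff_fwdDiff_iter {k : WithTop ℕ∞} {f : E → F} (hf : ContDiff ℝ k f) (h : E) (p : ℕ) :
    ContDiff ℝ k ((fwdDiff h)^[p] f) := by
  induction p with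
  | zero => exact hf
  | succ p ih =>
    rw [Function.iterate_succ_apply']
    exact contDiff_fwdDiff ih h

theorem fderiv_fwdDiff {f : E → F} (hf : Differentiable ℝ f) (h : E) :
    fderiv ℝ (fwdDiff h f) = fwdDiff h (fderiv ℝ f) := by
  funext x
  have h1 : DifferentiableAt ℝ (fun y => f (y + h)) x :=
    (hf _).comp x (differentiableAt_id.add_const h)
  change fderiv ℝ (fun y => f (y + h) - f y) x = _
  rw [fderiv_fun_sub h1 (hf x), fderiv_comp_add_right]
  rfl

theorem fderiv_fwdDiff_iter {f : E → F} (hf : ContDiff ℝ 1 f) (h : E) (p : ℕ) :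
    fderiv ℝ ((fwdDiff h)^[p] f) = (fwdDiff h)^[p] (fderiv ℝ f) := by
  induction p with
  | zero => rfl
  | succ p ih =>
    rw [Function.iterate_succ_apply', Function.iterate_succ_apply', ← ih,
      fderiv_fwdDiff ((contDiff_fwdDiff_iter hf h p).differentiable one_ne_zero)]

/-- Iterated differences commute with additive maps of the values. -/
theorem fwdDiff_iter_map_comp {M G H : Type*} [AddCommMonoid M] [AddCommGroup G] [AddCommGroup H]
    (L : G →+ H) (f : M → G) (h : M) (p : ℕ) (x : M) :
    (fwdDiff h)^[p] (fun y => L (f y)) x = L ((fwdDiff h)^[p] f x) := by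
  induction p generalizing x with
  | zero => rfl
  | succ p ih => simp [Function.iterate_succ_apply', fwdDiff, ih]

/-- Iterated differences in the source are transported by an affine map. -/
theorem fwdDiff_iter_comp_map_sub {M N G : Type*} [AddCommGroup M] [AddCommGroup N]
    [AddCommGroup G] (A : M →+ N) (b : N) (f : N → G) (h : M) (p : ℕ) (x : M) :
    (fwdDiff h)^[p] (fun y => f (A y - b)) x = (fwdDiff (A h))^[p] f (A x - b) := by
  induction p generalizing x with
  | zero => rfl
  | succ p ih =>
    have : A x + A h - b = A x - b + A h := by abel
    simp [Function.iterate_succ_apply', fwdDiff, ih, this]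

/-- The mean value inequality, with a bound on the derivative in the direction of the increment. -/
theorem norm_fwdDiff_le {f : E → F} (hf : Differentiable ℝ f) (h : E) {C : ℝ}
    (hC : ∀ x, ‖fderiv ℝ f x h‖ ≤ C) (x : E) : ‖fwdDiff h f x‖ ≤ C := by
  have hd : ∀ t : ℝ, HasDerivAt (fun t : ℝ => f (x + t • h)) (fderiv ℝ f (x + t • h) h) t := by
    intro t
    have h1 : HasDerivAt (fun t : ℝ => x + t • h) h t := by
      simpa using ((hasDerivAt_id t).smul_const h).const_add x
    exact (hf _).hasFDerivAt.comp_hasDerivAt t h1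
  simpa [fwdDiff] using norm_image_sub_le_of_norm_deriv_le_segment_01'
    (fun t _ => (hd t).hasDerivWithinAt) (fun t _ => hC _)

/-- A bound on the `p`-th derivative bounds the differences of order `p`. -/
theorem norm_fwdDiff_iter_le {f : E → F} {p : ℕ} (hf : ContDiff ℝ p f) {C : ℝ}
    (hC : ∀ x, ‖iteratedFDeriv ℝ p f x‖ ≤ C) (h x : E) :
    ‖(fwdDiff h)^[p] f x‖ ≤ C * ‖h‖ ^ p := by
  induction p generalizing f C x with
  | zero => simpa using hC x
  | succ p ih =>
    have hf1 : ContDiff ℝ 1 f := hf.of_le (by exact_mod_cast Nat.le_add_left 1 p)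
    have hf' : ContDiff ℝ p (fderiv ℝ f) := hf.fderiv_right (by norm_cast)
    rw [Function.iterate_succ_apply']
    refine norm_fwdDiff_le ((contDiff_fwdDiff_iter hf1 h p).differentiable one_ne_zero) h
      (fun y => ?_) x
    -- The derivative of `Δ_h^p f` in direction `h` is `Δ_h^p` of that of `f`.
    have hcomm : fderiv ℝ ((fwdDiff h)^[p] f) y h
        = (fwdDiff h)^[p] (fun z => fderiv ℝ f z h) y := by
      rw [fderiv_fwdDiff_iter hf1]
      exact (fwdDiff_iter_map_comp
        (ContinuousLinearMap.apply ℝ F h : (E →L[ℝ] F) →L[ℝ] F).toLinearMap.toAddMonoidHom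
        (fderiv ℝ f) h p y).symm
    rw [hcomm]
    refine (ih (f := fun z => fderiv ℝ f z h) (C := ‖h‖ * C) (hf'.clm_apply contDiff_const)
      (fun z => ?_) y).trans_eq (by ring)
    refine (norm_iteratedFDeriv_clm_apply_const hf'.contDiffAt le_rfl).trans ?_
    rw [norm_iteratedFDeriv_fderiv]
    exact mul_le_mul_of_nonneg_left (hC z) (norm_nonneg h)

end Differences

theorem norm_fwdDiff_iter_le_of_bounded {M G : Type*} [AddCommMonoid M]
    [SeminormedAddCommGroup G] {f : M → G} {C : ℝ} (hC : ∀ x, ‖f x‖ ≤ C) (h : M) (p : ℕ) (x : M) : ‖(fwdDiff h)^[p] f x‖ ≤ 2 ^ p * C := by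
  induction p generalizing x with
  | zero => simpa using hC x
  | succ p ih =>
    rw [Function.iterate_succ_apply', fwdDiff]
    refine (norm_sub_le _ _).trans ((add_le_add (ih _) (ih _)).trans_eq (by ring))

/-! ### Membership in the Zygmund space -/

section Membership

variable {𝕜 : Type*} [RCLike 𝕜] {n : ℕ} {σ : ℝ}

/-- For a bounded function, a bound `‖h‖ ^ τ` with `τ ≥ σ` suffices: it gives the required one for
`‖h‖ ≤ 1`, and the differences of a bounded function are bounded. -/
theorem memZygmund_of_diff_le (hσ : 0 < σ) {τ : ℝ} (hτ : σ ≤ τ)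
    {f : EuclideanSpace ℝ (Fin n) → 𝕜} (hf : Continuous f) {A B : ℝ} (hA : ∀ x, ‖f x‖ ≤ A)
    (hB : ∀ h x, ‖diff σ h f x‖ ≤ B * ‖h‖ ^ τ) : MemZygmund σ f := by
  have hA0 : 0 ≤ A := (norm_nonneg _).trans (hA 0)
  refine ⟨hf, ⟨A, hA⟩, |B| + 2 ^ (⌊σ⌋₊ + 1) * A, fun h x => ?_⟩
  rcases le_total ‖h‖ 1 with h1 | h1
  · have h2 : ‖h‖ ^ τ ≤ ‖h‖ ^ σ :=
      Real.rpow_le_rpow_of_exponent_ge' (norm_nonneg h) h1 hσ.le hτ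
    calc ‖diff σ h f x‖ ≤ B * ‖h‖ ^ τ := hB h x
      _ ≤ |B| * ‖h‖ ^ σ := mul_le_mul (le_abs_self B) h2 (by positivity) (abs_nonneg B)
      _ ≤ _ := mul_le_mul_of_nonneg_right (le_add_of_nonneg_right (by positivity)) (by positivity)
  · calc ‖diff σ h f x‖ ≤ 2 ^ (⌊σ⌋₊ + 1) * A := norm_fwdDiff_iter_le_of_bounded hA h _ x
      _ ≤ |B| + 2 ^ (⌊σ⌋₊ + 1) * A := le_add_of_nonneg_left (abs_nonneg B)
      _ ≤ _ := le_mul_of_one_le_right (by positivity) (Real.one_le_rpow h1 hσ.le)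

theorem MemHolder.memZygmund (hσ : 0 < σ) {r : ℝ} (hr : σ < r)
    {f : EuclideanSpace ℝ (Fin n) → 𝕜} (hf : MemHolder r f) : MemZygmund σ f := by
  obtain ⟨hcd, hbd, K, hK⟩ := hf
  obtain ⟨A, hA⟩ := (hbd 0 (Nat.zero_le _)).2
  simp only [norm_iteratedFDeriv_zero] at hA
  have hσr : ⌊σ⌋₊ ≤ ⌊r⌋₊ := Nat.floor_mono hr.le
  rcases hσr.lt_or_eq with hlt | heq
  · -- All derivatives of order `⌊σ⌋ + 1` are bounded.
    obtain ⟨B, hB⟩ := (hbd (⌊σ⌋₊ + 1) hlt).2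
    refine memZygmund_of_diff_le hσ (τ := ((⌊σ⌋₊ + 1 : ℕ) : ℝ)) ?_ hcd.continuous hA
      (B := B) (fun h x => ?_)
    · push_cast
      exact (Nat.lt_floor_add_one σ).le
    · rw [Real.rpow_natCast]
      exact norm_fwdDiff_iter_le (hcd.of_le (by exact_mod_cast hlt)) hB h x
  · -- `Δ_h f` has derivatives of order `⌊r⌋` of size `‖h‖ ^ (r - ⌊r⌋)`.
    refine memZygmund_of_diff_le hσ hr.le hcd.continuous hA (B := K) (fun h x => ?_)
    have hsub : ∀ y, ‖iteratedFDeriv ℝ ⌊r⌋₊ (fwdDiff h f) y‖ ≤ K * ‖h‖ ^ (r - (⌊r⌋₊ : ℝ)) := by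
      intro y
      have h1 : ContDiff ℝ (⌊r⌋₊ : ℕ) (fun z => f (z + h)) :=
        hcd.comp (contDiff_id.add contDiff_const)
      have h2 := iteratedFDeriv_sub_apply (x := y) h1.contDiffAt hcd.contDiffAt
      rw [iteratedFDeriv_comp_add_right] at h2
      change iteratedFDeriv ℝ ⌊r⌋₊ (fwdDiff h f) y = _ at h2
      rw [h2]
      simpa using hK (y + h) y
    have h3 := norm_fwdDiff_iter_le (contDiff_fwdDiff hcd h) hsub h x
    rw [diff, heq, Function.iterate_succ_apply]
    refine h3.trans_eq ?_
    rw [mul_assoc, ← Real.rpow_add_natCast' (norm_nonneg h) (by linarith), sub_add_cancel]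

theorem MemZygmund.comp_sub (hσ : 0 < σ) {f : EuclideanSpace ℝ (Fin n) → 𝕜} (hf : MemZygmund σ f)
    (A : EuclideanSpace ℝ (Fin n) →L[ℝ] EuclideanSpace ℝ (Fin n)) (b : EuclideanSpace ℝ (Fin n)) :
    MemZygmund σ (fun x => f (A x - b)) := by
  obtain ⟨hc, ⟨B, hB⟩, C, hC⟩ := hf
  refine ⟨hc.comp (A.continuous.sub continuous_const), ⟨B, fun x => hB _⟩, |C| * ‖A‖ ^ σ,
    fun h x => ?_⟩
  have h1 : diff σ h (fun x => f (A x - b)) x = diff σ (A h) f (A x - b) :=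
    fwdDiff_iter_comp_map_sub A.toLinearMap.toAddMonoidHom b f h _ x
  rw [h1, mul_assoc, ← Real.mul_rpow (norm_nonneg _) (norm_nonneg _)]
  refine (hC _ _).trans (mul_le_mul (le_abs_self C) ?_ (by positivity) (abs_nonneg C))
  exact Real.rpow_le_rpow (norm_nonneg _) (A.le_opNorm h) hσ.le

/-- The factor `ψ₁(2ʲ xᵢ - kᵢ)` is `φ(2ʲ⁺¹ xᵢ - (2 kᵢ + 1))`, so a wavelet is `φ^[n]` composed with
an affine map whose linear part is diagonal. -/
theorem wavelet_eq_tensorScaling_comp (φ : ℝ → 𝕜) (α : (Fin n → Fin 2) × ℤ × (Fin n → ℤ)) :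
    ∃ (A : EuclideanSpace ℝ (Fin n) →L[ℝ] EuclideanSpace ℝ (Fin n))
      (b : EuclideanSpace ℝ (Fin n)),
      wavelet φ α = fun x => tensorScaling n φ (A x - b) := by
  let d : Fin n → ℝ := fun i => if α.1 i = 0 then (2 : ℝ) ^ α.2.1 else 2 * (2 : ℝ) ^ α.2.1
  let A : EuclideanSpace ℝ (Fin n) →L[ℝ] EuclideanSpace ℝ (Fin n) :=
    LinearMap.toContinuousLinearMap (Matrix.toEuclideanLin (Matrix.diagonal d))
  refine ⟨A, WithLp.toLp 2 fun i => if α.1 i = 0 then (α.2.2 i : ℝ) else 2 * (α.2.2 i : ℝ) + 1, ?_⟩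
  funext x
  refine Finset.prod_congr rfl fun i _ => ?_
  have hA : (A x) i = d i * x i := by
    simp [A, Matrix.toLpLin_apply, Matrix.mulVec_diagonal]
  simp only [motherFun, PiLp.sub_apply, hA, d]
  split_ifs with h
  · rfl
  · congr 1
    ring

end Membership

/-! ### Cosine waves and non-separability -/

section Separability

variable {𝕜 : Type*} [RCLike 𝕜] {n : ℕ} {σ : ℝ}

/-- The function `x ↦ cos (t xᵢ)` on `ℝⁿ`, with values in `𝕜`. -/
noncomputable def cosWave (𝕜 : Type*) [RCLike 𝕜] {n : ℕ} (i : Fin n) (t : ℝ) :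
    EuclideanSpace ℝ (Fin n) → 𝕜 :=
  fun x => (Real.cos (t * x i) : 𝕜)

/-- Each difference multiplies a cosine wave by `2 sin (t hᵢ / 2)` and shifts its phase by
`t hᵢ / 2 + π / 2`. -/
theorem fwdDiff_iter_cosWave (i : Fin n) (t : ℝ) (h : EuclideanSpace ℝ (Fin n)) (p : ℕ)
    (x : EuclideanSpace ℝ (Fin n)) :
    (fwdDiff h)^[p] (cosWave 𝕜 i t) x
      = (((2 * Real.sin (t * h i / 2)) ^ p
          * Real.cos (t * x i + p * (t * h i / 2 + Real.pi / 2)) : ℝ) : 𝕜) := by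
  induction p generalizing x with
  | zero => simp [cosWave]
  | succ p ih =>
    rw [Function.iterate_succ_apply', fwdDiff, ih, ih, ← RCLike.ofReal_sub, ← mul_sub,
      Real.cos_sub_cos, pow_succ]
    congr 1
    have h1 : (t * (x + h) i + p * (t * h i / 2 + Real.pi / 2)
        + (t * x i + p * (t * h i / 2 + Real.pi / 2))) / 2
        = t * x i + p * (t * h i / 2 + Real.pi / 2) + t * h i / 2 := by
      simp only [PiLp.add_apply]
      ring
    have h2 : (t * (x + h) i + p * (t * h i / 2 + Real.pi / 2)
        - (t * x i + p * (t * h i / 2 + Real.pi / 2))) / 2 = t * h i / 2 := by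
      simp only [PiLp.add_apply]
      ring
    have h3 : t * x i + (p + 1 : ℕ) * (t * h i / 2 + Real.pi / 2)
        = t * x i + p * (t * h i / 2 + Real.pi / 2) + t * h i / 2 + Real.pi / 2 := by
      push_cast
      ring
    rw [h1, h2, h3, Real.cos_add_pi_div_two]
    ring

theorem memZygmund_cosWave (hσ : 0 < σ) (i : Fin n) (t : ℝ) : MemZygmund σ (cosWave 𝕜 i t) := by
  refine memZygmund_of_diff_le hσ (τ := ((⌊σ⌋₊ + 1 : ℕ) : ℝ)) (A := 1)
    (B := |t| ^ (⌊σ⌋₊ + 1)) ?_ ?_ (fun x => ?_) (fun h x => ?_)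
  · push_cast
    exact (Nat.lt_floor_add_one σ).le
  · unfold cosWave
    fun_prop
  · simpa [cosWave] using Real.abs_cos_le_one (t * x i)
  · have h1 : |2 * Real.sin (t * h i / 2)| ≤ |t| * ‖h‖ := by
      have h2 := Real.abs_sin_le_abs (x := t * h i / 2)
      rw [abs_div, abs_mul t, abs_two] at h2
      rw [abs_mul, abs_two]
      have h3 : |t| * |h i| ≤ |t| * ‖h‖ :=
        mul_le_mul_of_nonneg_left (PiLp.norm_apply_le h i) (abs_nonneg t)
      linarith
    rw [diff, fwdDiff_iter_cosWave, RCLike.norm_ofReal, abs_mul, abs_pow, Real.rpow_natCast,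
      ← mul_pow]
    exact (mul_le_of_le_one_right (by positivity) (Real.abs_cos_le_one _)).trans
      (pow_le_pow_left₀ (abs_nonneg _) h1 _)

/-- While `cos` stays positive along the doublings of an angle, `1 - cos` at least doubles, which
cannot go on forever unless `cos θ = 1`. -/
theorem exists_cos_two_pow_mul_nonpos {θ : ℝ} (hθ : Real.cos θ ≠ 1) :
    ∃ k : ℕ, Real.cos (2 ^ k * θ) ≤ 0 := by
  by_contra! hpos
  have hδ : 0 < 1 - Real.cos θ := sub_pos.mpr (lt_of_le_of_ne (Real.cos_le_one θ) hθ)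
  have hgrow : ∀ k : ℕ, 2 ^ k * (1 - Real.cos θ) ≤ 1 - Real.cos (2 ^ k * θ) := by
    intro k
    induction k with
    | zero => simp
    | succ k ih =>
      have h1 : (2 : ℝ) ^ (k + 1) * θ = 2 * (2 ^ k * θ) := by ring
      rw [h1, Real.cos_two_mul, pow_succ]
      nlinarith [hpos k, Real.cos_le_one (2 ^ k * θ)]
  obtain ⟨k, hk⟩ := pow_unbounded_of_one_lt (1 - Real.cos θ)⁻¹ (one_lt_two : (1 : ℝ) < 2)
  have h2 : 1 < 2 ^ k * (1 - Real.cos θ) := by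
    rwa [inv_lt_iff_one_lt_mul₀ hδ] at hk
  linarith [hgrow k, hpos k]

/-- The point `y` is a multiple `2 ^ k` of the period `2π / t` of the wave of frequency `t`, chosen so
that the wave of the lower frequency `s` is not positive there. -/
theorem exists_cos_eq_one_and_cos_nonpos {s t : ℝ} (hs : 0 < s) (hst : s < t) :
    ∃ y : ℝ, Real.cos (t * y) = 1 ∧ Real.cos (s * y) ≤ 0 := by
  have ht : 0 < t := hs.trans hst
  have hθ : Real.cos (2 * Real.pi * (s / t)) ≠ 1 := by
    have hq : s / t < 1 := (div_lt_one ht).mpr hst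
    have hq0 : 0 < s / t := div_pos hs ht
    intro h
    have hpi := Real.pi_pos
    rw [Real.cos_eq_one_iff_of_lt_of_lt (by nlinarith) (by nlinarith)] at h
    have : 0 < 2 * Real.pi * (s / t) := by positivity
    exact this.ne' h
  obtain ⟨k, hk⟩ := exists_cos_two_pow_mul_nonpos hθ
  refine ⟨2 ^ k * (2 * Real.pi / t), ?_, ?_⟩
  · have h1 : t * (2 ^ k * (2 * Real.pi / t)) = (2 ^ k : ℕ) * (2 * Real.pi) := by
      push_cast
      field_simp
    rw [h1, Real.cos_nat_mul_two_pi]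
  · have h1 : s * (2 ^ k * (2 * Real.pi / t)) = 2 ^ k * (2 * Real.pi * (s / t)) := by ring
    rwa [h1]

theorem ZygmundSpace.norm_apply_sub_le_dist (f g : ZygmundSpace 𝕜 n σ)
    (x : EuclideanSpace ℝ (Fin n)) : ‖f.1 x - g.1 x‖ ≤ dist f g := by
  rw [dist_eq_norm, norm_def]
  exact (le_ciSup (f - g).bdd_sup x).trans
    (le_add_of_nonneg_right (Real.iSup_nonneg fun _ => by positivity))

theorem one_le_dist_cosWave (hσ : 0 < σ) (i : Fin n) {s t : ℝ} (hs : 0 < s) (hst : s < t) :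
    1 ≤ dist (ZygmundSpace.ofFun (cosWave 𝕜 i s) (memZygmund_cosWave hσ i s))
      (ZygmundSpace.ofFun (cosWave 𝕜 i t) (memZygmund_cosWave hσ i t)) := by
  obtain ⟨y, hty, hsy⟩ := exists_cos_eq_one_and_cos_nonpos hs hst
  refine le_trans ?_ (ZygmundSpace.norm_apply_sub_le_dist _ _ (EuclideanSpace.single i y))
  change 1 ≤ ‖cosWave 𝕜 i s (EuclideanSpace.single i y)
    - cosWave 𝕜 i t (EuclideanSpace.single i y)‖
  have h1 : cosWave 𝕜 i s (EuclideanSpace.single i y)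
      - cosWave 𝕜 i t (EuclideanSpace.single i y)
      = ((Real.cos (s * y) - Real.cos (t * y) : ℝ) : 𝕜) := by
    simp [cosWave]
  rw [h1, RCLike.norm_ofReal, hty, le_abs]
  right
  linarith

theorem not_separableSpace_zygmundSpace (hn : 0 < n) (hσ : 0 < σ) :
    ¬ TopologicalSpace.SeparableSpace (ZygmundSpace 𝕜 n σ) := by
  intro hsep
  let F : ℝ → ZygmundSpace 𝕜 n σ := fun t =>
    ZygmundSpace.ofFun (cosWave 𝕜 ⟨0, hn⟩ t) (memZygmund_cosWave hσ ⟨0, hn⟩ t)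
  have hdisj : (Set.Ioi (0 : ℝ)).PairwiseDisjoint fun t => Metric.ball (F t) (1 / 2) := by
    intro s hs t ht hst
    refine Metric.ball_disjoint_ball ?_
    rw [add_halves]
    rcases lt_or_gt_of_ne hst with h | h
    · exact one_le_dist_cosWave hσ _ hs h
    · rw [dist_comm]
      exact one_le_dist_cosWave hσ _ ht h
  have hcount : (Set.Ioi (0 : ℝ)).Countable :=
    hdisj.countable_of_isOpen (fun _ _ => Metric.isOpen_ball)
      (fun t _ => ⟨F t, Metric.mem_ball_self (by norm_num)⟩)
  rw [← Cardinal.le_aleph0_iff_set_countable, Cardinal.mk_Ioi_real] at hcount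
  exact hcount.not_gt Cardinal.aleph0_lt_continuum

theorem IsSchauderBasis.separableSpace {X : Type*} [NormedAddCommGroup X] [NormedSpace 𝕜 X]
    {e : ℕ → X} (he : IsSchauderBasis 𝕜 e) : TopologicalSpace.SeparableSpace X := by
  have hsep : TopologicalSpace.IsSeparable
      (closure (Submodule.span 𝕜 (Set.range e) : Set X)) :=
    ((Set.countable_range e).isSeparable.span (R := 𝕜)).closure
  rw [← TopologicalSpace.isSeparable_univ_iff]
  refine hsep.mono fun x _ => ?_
  obtain ⟨a, ha, -⟩ := he x
  refine mem_closure_of_tendsto ha (Eventually.of_forall fun N => ?_)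
  exact Submodule.sum_mem _ fun k _ =>
    Submodule.smul_mem _ _ (Submodule.subset_span (Set.mem_range_self k))

end Separability

end InterpWavelet

theorem mainTheorem3 {𝕜 : Type*} [RCLike 𝕜] (n : ℕ) (hn : 0 < n) (σ : ℝ) (hσ : 0 < σ) (j₀ : ℤ)
    (φ : ℝ → 𝕜) (hφ : InterpWavelet.IsInterpolatingTensorMRA n φ)
    (hr : ∃ r : ℝ, σ < r ∧ InterpWavelet.MemHolder r (InterpWavelet.tensorScaling n φ)) :
    ∃ hψ : ∀ α : InterpWavelet.waveletIndex n j₀,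
        InterpWavelet.MemZygmund σ (InterpWavelet.wavelet φ α.1),
      ∀ ι : ℕ ≃ InterpWavelet.waveletIndex n j₀,
        ¬ InterpWavelet.IsSchauderBasis 𝕜 (fun k : ℕ =>
          InterpWavelet.ZygmundSpace.ofFun (InterpWavelet.wavelet φ (ι k).1) (hψ (ι k))) := by
  obtain ⟨r, hσr, hr⟩ := hr
  refine ⟨fun α => ?_, fun ι hbasis =>
    InterpWavelet.not_separableSpace_zygmundSpace hn hσ hbasis.separableSpace⟩
  obtain ⟨A, b, hAb⟩ := InterpWavelet.wavelet_eq_tensorScaling_comp φ α.1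
  rw [hAb]
  exact (hr.memZygmund hσ hσr).comp_sub hσ A b
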